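/- **Theorem (PCE reduces to SPCE).** For integers $k,n\ge 1$, a finite field $\mathbb F_q$ with $q$ elements and matrices $G,H\in\mathbb F_q^{k\times n}$, say that $(G,H)$ is in $\mathrm{PCE}$ if $SGP=H$ for some $S\in \mathrm{GL}_k(\mathbb F_q)$ and some $n\times n$ permutation matrix $P$ over $\mathbb F_q$; and that $(G,H)$ is in $\mathrm{SPCE}$ if $SGP=H$ for some $S\in \mathrm{GL}_k(\mathbb F_q)$ and some $n\times n$ signed permutation matrix $P$ (exactly one non-zero entry in each row and each column, each of them equal to $1$ or $-1$). There is a deterministic polynomial-time Karp reduction from Permutation Code Equivalence to Signed Permutation Code Equivalence: there is a function $f$, computed by a single deterministic (multi-stack) Turing machine, uniformly for all finite fields, that maps every pair $(G,H)$ of $k\times n$ matrices over $\mathbb F_q$ to a pair $f(G,H)$ of matrices of a common size over the same field $\mathbb F_q$, such that $$(G,H)\in \mathrm{PCE}\iff f(G,H)\in\mathrm{SPCE}.$$ If $G$ and $H$ are generator matrices (that is, their rows are linearly independent), then so are both matrices of $f(G,H)$, and on all such inputs the machine runs in $\mathrm{poly}(n,\log q)$ time, where $n$ is the blocklength and $q$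 the field size of the input pair. On arbitrary pairs of $k\times n$ matrices it runs in $\mathrm{poly}(k,n,\log q)$ time. Here $\mathbb F_q$, $q=p^r$, is given as $\mathbb F_p[X]/(g)$ by the prime $p$ and a monic irreducible polynomial $g$ of degree $r$; field elements are given by their $r$ coefficients, written in binary as integers in $\{0,\dots,p-1\}$; and matrices are listed entry by entry. -/

import Mathlib

namespace CodeEquivalence

open Polynomial

/-! ## Matrix groups and equivalence of codes -/

section Problems

variable {F : Type} [Field F]

/-- Exactly one non-zero entry in each row and in each column. -/
def OneNonzeroPerLine {n : ℕ} (P : Matrix (Fin n) (Fin n) F) : Prop :=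
  (∀ i, ∃! j, P i j ≠ 0) ∧ (∀ j, ∃! i, P i j ≠ 0)

/-- Permutation matrices: one non-zero entry per row and column, all of them equal to `1`. -/
def IsPermutationMatrix {n : ℕ} (P : Matrix (Fin n) (Fin n) F) : Prop :=
  OneNonzeroPerLine P ∧ ∀ i j, P i j ≠ 0 → P i j = 1

/-- Signed permutation matrices: one non-zero entry per row and column, each `1` or `-1`. -/
def IsSignedPermutationMatrix {n : ℕ} (P : Matrix (Fin n) (Fin n) F) : Prop :=
  OneNonzeroPerLine P ∧ ∀ i j, P i j ≠ 0 → P i j = 1 ∨ P i j = -1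

variable (F) in
/-- A pair of `k × n` matrices over `F`, with `k, n ≥ 1`. -/
structure MatrixPair where
  k : ℕ
  n : ℕ
  k_pos : 0 < k
  n_pos : 0 < n
  G : Matrix (Fin k) (Fin n) F
  H : Matrix (Fin k) (Fin n) F

namespace MatrixPair

/-- Both matrices have linearly independent rows, that is, each of them is a generator matrix of
a code of dimension `k` and blocklength `n`. -/
def IsGeneratorPair (x : MatrixPair F) : Prop :=
  LinearIndependent F x.G.row ∧ LinearIndependent F x.H.row

/-- The YES instances of Permutation Code Equivalence. -/
def PCE (x : MatrixPair F) : Prop :=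
  ∃ (S : GL (Fin x.k) F) (P : Matrix (Fin x.n) (Fin x.n) F),
    IsPermutationMatrix P ∧ (S : Matrix (Fin x.k) (Fin x.k) F) * x.G * P = x.H

/-- The YES instances of Signed Permutation Code Equivalence. -/
def SPCE (x : MatrixPair F) : Prop :=
  ∃ (S : GL (Fin x.k) F) (P : Matrix (Fin x.n) (Fin x.n) F),
    IsSignedPermutationMatrix P ∧ (S : Matrix (Fin x.k) (Fin x.k) F) * x.G * P = x.H

end MatrixPair

end Problems

/-! ## Finite fields as they are given to a machine -/

/-- The usual presentation of a finite field as `𝔽_p[X] / (g)`, where `p` is a prime number and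
`g` is a monic irreducible polynomial over `𝔽_p`. -/
structure FieldPresentation where
  p : ℕ
  prime : p.Prime
  modulus : (ZMod p)[X]
  monic : modulus.Monic
  irreducible : Irreducible modulus

namespace FieldPresentation

instance factPrime (D : FieldPresentation) : Fact D.p.Prime := ⟨D.prime⟩

instance factIrreducible (D : FieldPresentation) : Fact (Irreducible D.modulus) := ⟨D.irreducible⟩

/-- The field that is presented. -/
abbrev Carrier (D : FieldPresentation) : Type := AdjoinRoot D.modulus

instance finiteCarrier (D : FieldPresentation) : Finite D.Carrier :=
  have : Module.Finite (ZMod D.p) D.Carrier := D.monic.finite_adjoinRoot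
  Module.finite_of_finite (ZMod D.p)

/-- The field size `q`. -/
noncomputable def q (D : FieldPresentation) : ℕ := Nat.card D.Carrier

end FieldPresentation

/-! ## Encoding of instances as strings -/

/-- The input and output alphabet: binary digits and four terminators. -/
inductive Symbol
  | bit (b : Bool)
  | endNumber
  | endEntry
  | endColumn
  | endPart
  deriving DecidableEq, Fintype

/-- A natural number in binary, least significant digit first, followed by a terminator. -/
def encodeNumber (a : ℕ) : List Symbol :=
  (Computability.encodeNat a).map Symbol.bit ++ [Symbol.endNumber]

section Encoding

variable (D : FieldPresentation)

/-- The presentation of the field: the prime `p` and the coefficients `g_0, …, g_r` of the modulus,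
where `r` is its degree. -/
def encodeField : List Symbol :=
  encodeNumber D.p ++
    (List.range (D.modulus.natDegree + 1)).flatMap
      (fun i => encodeNumber (D.modulus.coeff i).val) ++ [Symbol.endPart]

/-- A field element: the coefficients `a_0, …, a_{r-1}` of its unique representative
`a_0 + a_1 X + … + a_{r-1} X ^ (r-1)` modulo `g`, as integers between `0` and `p - 1`. -/
noncomputable def encodeElement (a : D.Carrier) : List Symbol :=
  (List.range D.modulus.natDegree).flatMap
    (fun i => encodeNumber ((AdjoinRoot.modByMonicHom D.monic a).coeff i).val) ++
      [Symbol.endEntry]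

/-- A matrix, column by column, each column from top to bottom. -/
noncomputable def encodeMatrix {k n : ℕ} (A : Matrix (Fin k) (Fin n) D.Carrier) : List Symbol :=
  (List.finRange n).flatMap
    (fun j => (List.finRange k).flatMap (fun i => encodeElement D (A i j)) ++
      [Symbol.endColumn]) ++ [Symbol.endPart]

/-- A whole instance: the field and the two matrices. -/
noncomputable def encodeInstance (x : MatrixPair D.Carrier) : List Symbol :=
  encodeField D ++ encodeMatrix D x.G ++ encodeMatrix D x.H

end Encoding

/-! ## Computation -/

/-- The (deterministic, multi-stack) Turing machine `M`, started on the string `input`, halts with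
output `output` after at most `t` steps. -/
def OutputsWithin {Γ₀ Γ₁ : Type} (M : Turing.TM2ComputableAux Γ₀ Γ₁)
    (input : List Γ₀) (output : List Γ₁) (t : ℕ) : Prop :=
  Nonempty (Turing.TM2OutputsInTime M.tm (input.map M.inputAlphabet.invFun)
    (some (output.map M.outputAlphabet.invFun)) t)

end CodeEquivalence

namespace CodeEquivalence

open Polynomial

/-! ### Code equivalence in terms of multisets of columns -/

section Columns

variable {F : Type} [Field F]

/-! Right multiplication by a permutation matrix only reorders columns. So PCE asks for a linear
automorphism of `F^k` carrying the multiset of columns of `G` to that of `H` (`MatrixPair.pce_iff`),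
and SPCE asks for the same with every column taken up to sign (`MatrixPair.spce_iff`). The reduction
has to make the signs harmless.

Fix `θ ≠ 0` and replace each column `v` by `(0,0,v)`, `(θ,0,v)`, `(0,θ,v)` and four copies each of
the pins `(θ,0,0)` and `(0,θ,0)`. An automorphism for PCE extends by the identity on the two new
coordinates. Conversely, let `S` match the two gadgets up to sign. With `n` original columns, each
pin occurs at least `4n` times, while a class other than those of the pins occurs at most `3n`
times; so `S` sends pins to pins, up to sign and order (`map_pin_eq`). Replacing `S` by `-S` if
necessary, the first pin goes exactly to a pin. In every gadget column the product of the two top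
entries is zero, a property that ignores signs; comparing `(0,0,v)`, `(θ,0,v)` and `(0,θ,v)` forces
`S(0,0,v)` to have zero top entries. The image of `(θ,0,v)` then carries a known non-zero top entry,
which fixes its sign; in characteristic 2 signs do not matter anyway. Counting these classes
recovers the columns of the target exactly (`exists_linearEquiv_of_pinImages`).

The gadget can be computed by symbol-by-symbol rewriting, without field arithmetic. Choosing for `θ`
the element with all coefficients one, a machine with a fixed number of stacks does it in time
linear in the length of the input (`outputsWithin_reduce`). That length is polynomial in `k`, `n`
and `log q`, and independent rows give `k ≤ n`. -/

theorem exists_perm_of_map_univ_eq {α β : Type} [Fintype α] (f g : α → β)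
    (h : Finset.univ.val.map f = Finset.univ.val.map g) :
    ∃ σ : Equiv.Perm α, ∀ a, g (σ a) = f a := by
  classical
  have key : ∀ c, Nonempty ({a // f a = c} ≃ {a // g a = c}) := by
    intro c
    refine ⟨Fintype.equivOfCardEq ?_⟩
    have h1 := congrArg (Multiset.count c) h
    rw [Multiset.count_map, Multiset.count_map] at h1
    rw [Fintype.card_subtype, Fintype.card_subtype]
    simp only [eq_comm (a := c)] at h1
    exact h1
  exact ⟨Equiv.ofFiberEquiv fun c => (key c).some, fun a => Equiv.ofFiberEquiv_map _ a⟩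

theorem map_univ_eq_iff_exists_perm {α β : Type} [Fintype α] (f g : α → β) :
    Finset.univ.val.map f = Finset.univ.val.map g ↔ ∃ σ : Equiv.Perm α, ∀ a, g (σ a) = f a := by
  refine ⟨exists_perm_of_map_univ_eq f g, ?_⟩
  rintro ⟨σ, hσ⟩
  have : f = g ∘ σ := funext fun a => (hσ a).symm
  rw [this, ← Multiset.map_map, Multiset.map_univ_val_equiv]

/-- `τ i` is the row of the only non-zero entry in column `i` of `P`, and `c` is that entry. The
predicate `Q` lets one proof serve both permutation and signed permutation matrices. -/
theorem exists_monomial_mul_eq_iff {k n : ℕ} (Q : F → Prop) (hQ : ∀ c, Q c → c ≠ 0)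
    (M N : Matrix (Fin k) (Fin n) F) :
    (∃ P : Matrix (Fin n) (Fin n) F,
        (OneNonzeroPerLine P ∧ ∀ i j, P i j ≠ 0 → Q (P i j)) ∧ M * P = N) ↔
      ∃ τ : Equiv.Perm (Fin n), ∀ i, ∃ c, Q c ∧ N.col i = c • M.col (τ i) := by
  constructor
  · rintro ⟨P, ⟨⟨hr, hc⟩, hP⟩, rfl⟩
    choose t ht hu using hc
    have inj : Function.Injective t := by
      intro i j hij
      obtain ⟨l, -, hl⟩ := hr (t i)
      rw [hl i (ht i), hl j (by simpa [hij] using ht j)]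
    refine ⟨Equiv.ofBijective t (Finite.injective_iff_bijective.1 inj), fun i =>
      ⟨P (t i) i, hP _ _ (ht i), ?_⟩⟩
    ext a
    simp only [Matrix.col_apply, Matrix.mul_apply, Pi.smul_apply, smul_eq_mul,
      Equiv.ofBijective_apply]
    rw [Finset.sum_eq_single (t i), mul_comm]
    · intro b _ hb
      by_contra h
      exact hb (hu i b (right_ne_zero_of_mul h))
    · simp
  · rintro ⟨τ, h⟩
    choose c hc h using h
    have hne : ∀ i j, (if i = τ j then c j else 0) ≠ 0 ↔ i = τ j := by
      intro i j
      by_cases hij : i = τ j <;> simp [hij, hQ _ (hc j)]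
    refine ⟨Matrix.of fun i j => if i = τ j then c j else 0, ⟨⟨fun i => ⟨τ.symm i, ?_, ?_⟩,
      fun j => ⟨τ j, ?_, ?_⟩⟩, fun i j hij => ?_⟩, ?_⟩
    · simp only [Matrix.of_apply, hne]; simp
    · intro j hj
      simp only [Matrix.of_apply, hne] at hj
      simp [hj]
    · exact (hne (τ j) j).2 rfl
    · intro i hi
      simpa only [Matrix.of_apply, hne] using hi
    · simp only [Matrix.of_apply, hne] at hij ⊢
      simpa [hij] using hc j
    · ext a i
      have := congrFun (h i) a
      simp only [Matrix.col_apply, Pi.smul_apply, smul_eq_mul] at this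
      simp [Matrix.mul_apply, this, mul_comm]

/-- The columns of a matrix, with multiplicity. -/
def columns {k n : ℕ} (A : Matrix (Fin k) (Fin n) F) : Multiset (Fin k → F) :=
  Finset.univ.val.map A.col

theorem exists_GL_iff_exists_linearEquiv {k : ℕ} (p : ((Fin k → F) → (Fin k → F)) → Prop) :
    (∃ S : GL (Fin k) F, p (S : Matrix (Fin k) (Fin k) F).mulVec) ↔
      ∃ A : (Fin k → F) ≃ₗ[F] (Fin k → F), p A := by
  constructor
  · rintro ⟨S, hS⟩
    refine ⟨LinearMap.GeneralLinearGroup.generalLinearEquiv F _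
      (Matrix.GeneralLinearGroup.toLin S), ?_⟩
    exact hS
  · rintro ⟨A, hA⟩
    refine ⟨Matrix.GeneralLinearGroup.toLin.symm
      ((LinearMap.GeneralLinearGroup.generalLinearEquiv F _).symm A), ?_⟩
    convert hA using 1
    ext1 v
    set S := Matrix.GeneralLinearGroup.toLin.symm
      ((LinearMap.GeneralLinearGroup.generalLinearEquiv F _).symm A)
    have : A = LinearMap.GeneralLinearGroup.generalLinearEquiv F _
      (Matrix.GeneralLinearGroup.toLin S) := by simp [S]
    rw [this]
    rfl

theorem col_mul_eq_mulVec {k n : ℕ} (S : Matrix (Fin k) (Fin k) F)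
    (G : Matrix (Fin k) (Fin n) F) (i : Fin n) :
    (S * G).col i = S.mulVec (G.col i) := rfl

theorem MatrixPair.pce_iff (x : MatrixPair F) :
    x.PCE ↔ ∃ A : (Fin x.k → F) ≃ₗ[F] (Fin x.k → F), (columns x.G).map A = columns x.H := by
  rw [← exists_GL_iff_exists_linearEquiv (fun A => (columns x.G).map A = columns x.H)]
  refine exists_congr fun S => ?_
  have h := exists_monomial_mul_eq_iff (fun c : F => c = 1) (by rintro _ rfl; simp)
    ((S : Matrix (Fin x.k) (Fin x.k) F) * x.G) x.H
  unfold IsPermutationMatrix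
  rw [h, columns, columns, Multiset.map_map, eq_comm, map_univ_eq_iff_exists_perm]
  simp [col_mul_eq_mulVec, eq_comm]

/-- A vector up to sign. -/
def upToSign {V : Type} [AddGroup V] (v : V) : Sym2 V := s(v, -v)

theorem upToSign_eq_iff {V : Type} [AddGroup V] {v w : V} :
    upToSign v = upToSign w ↔ v = w ∨ v = -w := by
  simp only [upToSign, Sym2.eq_iff]
  constructor
  · rintro (h | h)
    exacts [Or.inl h.1, Or.inr h.1]
  · rintro (h | h) <;> simp [h]

@[simp] theorem upToSign_neg {V : Type} [AddGroup V] (v : V) : upToSign (-v) = upToSign v :=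
  upToSign_eq_iff.2 (Or.inr rfl)

theorem MatrixPair.spce_iff (x : MatrixPair F) :
    x.SPCE ↔ ∃ A : (Fin x.k → F) ≃ₗ[F] (Fin x.k → F),
      (columns x.G).map (fun v => upToSign (A v)) = (columns x.H).map upToSign := by
  rw [← exists_GL_iff_exists_linearEquiv
    (fun A => (columns x.G).map (fun v => upToSign (A v)) = (columns x.H).map upToSign)]
  refine exists_congr fun S => ?_
  have h := exists_monomial_mul_eq_iff (fun c : F => c = 1 ∨ c = -1)
    (by rintro _ (rfl | rfl) <;> simp) ((S : Matrix (Fin x.k) (Fin x.k) F) * x.G) x.H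
  unfold IsSignedPermutationMatrix
  rw [h, columns, columns, Multiset.map_map, Multiset.map_map, eq_comm,
    map_univ_eq_iff_exists_perm]
  refine exists_congr fun τ => forall_congr' fun i => ?_
  simp only [Function.comp_apply]
  rw [eq_comm (b := upToSign (x.H.col i)), upToSign_eq_iff]
  simp [col_mul_eq_mulVec, or_and_right, exists_or]

end Columns

/-! ### The gadget and its rigidity under signs -/

section Gadget

variable {F : Type} {k : ℕ}

/-- Two entries on top of a vector. -/
def extend (a b : F) (v : Fin k → F) : Fin (k + 2) → F := Fin.cons a (Fin.cons b v)

@[simp] theorem extend_zero (a b : F) (v : Fin k → F) : extend a b v 0 = a := rfl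
@[simp] theorem extend_one (a b : F) (v : Fin k → F) : extend a b v 1 = b := rfl

theorem extend_eta (x : Fin (k + 2) → F) :
    extend (x 0) (x 1) (fun i => x i.succ.succ) = x := by
  funext i
  refine Fin.cases rfl (fun i => Fin.cases rfl (fun i => rfl) i) i

theorem extend_inj {a b a' b' : F} {v v' : Fin k → F} :
    extend a b v = extend a' b' v' ↔ a = a' ∧ b = b' ∧ v = v' := by
  constructor
  · intro h
    exact ⟨congrFun h 0, congrFun h 1, funext fun i => congrFun h i.succ.succ⟩
  · rintro ⟨rfl, rfl, rfl⟩; rfl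

variable [Field F]

theorem extend_add (a b a' b' : F) (v v' : Fin k → F) :
    extend a b v + extend a' b' v' = extend (a + a') (b + b') (v + v') := by
  rw [← extend_eta (_ + _)]; rfl

theorem extend_smul (c a b : F) (v : Fin k → F) :
    c • extend a b v = extend (c * a) (c * b) (c • v) := by
  rw [← extend_eta (_ • _)]; rfl

theorem extend_neg (a b : F) (v : Fin k → F) : -extend a b v = extend (-a) (-b) (-v) := by
  rw [← extend_eta (-_)]; rfl

/-- The columns that replace a column `v`. -/
def block (θ : F) (v : Fin k → F) : List (Fin (k + 2) → F) :=
  [extend 0 0 v, extend θ 0 v, extend 0 θ v] ++ List.replicate 4 (extend θ 0 0) ++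
    List.replicate 4 (extend 0 θ 0)

@[simp] theorem length_block (θ : F) (v : Fin k → F) : (block θ v).length = 11 := rfl

/-- The columns that replace all the columns of a matrix. -/
def gadget (θ : F) (M : Multiset (Fin k → F)) : Multiset (Fin (k + 2) → F) :=
  M.map (extend 0 0) + M.map (extend θ 0) + M.map (extend 0 θ) +
    Multiset.replicate (4 * M.card) (extend θ 0 0) + Multiset.replicate (4 * M.card) (extend 0 θ 0)

theorem coe_flatMap_block (θ : F) (L : List (Fin k → F)) :
    ((L.flatMap (block θ) : List _) : Multiset (Fin (k + 2) → F)) = gadget θ L := by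
  induction L with
  | nil => simp [gadget]
  | cons v L ih =>
    rw [List.flatMap_cons, ← Multiset.coe_add, ih, block, gadget, gadget, ← Multiset.coe_add,
      ← Multiset.coe_add, Multiset.coe_replicate, Multiset.coe_replicate, ← Multiset.cons_coe v L]
    simp only [Multiset.map_cons, Multiset.card_cons, mul_add, mul_one, Multiset.replicate_add]
    simp only [← Multiset.cons_coe, ← Multiset.singleton_add, Multiset.coe_nil, add_zero]
    abel

/-- Being quadratic, this condition on the top entries is unaffected by a change of sign, so it
passes through a matching up to sign. -/
theorem mem_gadget {θ : F} {M : Multiset (Fin k → F)} {x : Fin (k + 2) → F} (h : x ∈ gadget θ M) :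
    x 0 * x 1 = 0 := by
  simp only [gadget, Multiset.mem_add, Multiset.mem_map, Multiset.mem_replicate] at h
  rcases h with (((⟨v, -, rfl⟩ | ⟨v, -, rfl⟩) | ⟨v, -, rfl⟩) | ⟨-, rfl⟩) | ⟨-, rfl⟩ <;> simp

theorem map_extend_gadget (θ : F) (A : (Fin k → F) →ₗ[F] (Fin k → F))
    (S : (Fin (k + 2) → F) → (Fin (k + 2) → F)) (hS : ∀ a b v, S (extend a b v) = extend a b (A v))
    (M : Multiset (Fin k → F)) : (gadget θ M).map S = gadget θ (M.map A) := by
  simp only [gadget, Multiset.map_add, Multiset.map_map, Multiset.map_replicate, Multiset.card_map,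
    hS, map_zero, Function.comp_def]

/-- The linear automorphism that fixes the two entries on top. -/
noncomputable def extendEquiv (A : (Fin k → F) ≃ₗ[F] (Fin k → F)) :
    (Fin (k + 2) → F) ≃ₗ[F] (Fin (k + 2) → F) :=
  LinearEquiv.ofInjectiveEndo
    { toFun := fun x => extend (x 0) (x 1) (A fun i => x i.succ.succ)
      map_add' := fun x y => by
        rw [extend_add, ← map_add]; rfl
      map_smul' := fun c x => by
        rw [RingHom.id_apply, extend_smul, ← map_smul]; rfl }
    (fun x y h => by
      obtain ⟨h0, h1, h2⟩ := extend_inj.1 h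
      rw [← extend_eta x, ← extend_eta y]
      exact extend_inj.2 ⟨h0, h1, A.injective h2⟩)

theorem extendEquiv_extend (A : (Fin k → F) ≃ₗ[F] (Fin k → F)) (a b : F) (v : Fin k → F) :
    extendEquiv A (extend a b v) = extend a b (A v) := rfl

/-- A non-zero top entry detects the sign. If both signs occur for the same top, then `2 = 0` and
negation is trivial. -/
theorem upToSign_extend_inj {a b : F} (hab : a ≠ 0 ∨ b ≠ 0) {v w : Fin k → F} :
    upToSign (extend a b v) = upToSign (extend a b w) ↔ v = w := by
  refine ⟨fun h => ?_, fun h => h ▸ rfl⟩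
  rw [upToSign_eq_iff, extend_neg, extend_inj, extend_inj] at h
  rcases h with h | ⟨h0, h1, h2⟩
  · exact h.2.2
  · have two : (2 : F) = 0 := by
      rcases hab with h | h
      · exact (mul_eq_zero.1 (by linear_combination h0 : (2 : F) * a = 0)).resolve_right h
      · exact (mul_eq_zero.1 (by linear_combination h1 : (2 : F) * b = 0)).resolve_right h
    rw [h2]
    funext i
    rw [Pi.neg_apply]
    linear_combination -(w i) * two

/-- Away from the pins, only the three families indexed by the columns contribute, each at most once
per column. This is why four copies of each pin per column suffice. -/
theorem count_map_upToSign_gadget_le [DecidableEq F] (θ : F) (N : Multiset (Fin k → F))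
    (x : Fin (k + 2) → F) (h1 : upToSign x ≠ upToSign (extend θ 0 0))
    (h2 : upToSign x ≠ upToSign (extend 0 θ 0)) :
    ((gadget θ N).map upToSign).count (upToSign x) ≤ 3 * N.card := by
  have key : ∀ f : (Fin k → F) → Sym2 (Fin (k + 2) → F),
      (N.map f).count (upToSign x) ≤ N.card := fun f =>
    (Multiset.count_le_card _ _).trans (Multiset.card_map _ _).le
  simp only [gadget, Multiset.map_add, Multiset.map_map, Multiset.map_replicate,
    Multiset.count_add, Multiset.count_replicate, if_neg h1.symm, if_neg h2.symm]
  have a := key (upToSign ∘ extend 0 0)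
  have b := key (upToSign ∘ extend θ 0)
  have c := key (upToSign ∘ extend 0 θ)
  omega

theorem map_pin_eq {θ : F} {M N : Multiset (Fin k → F)} (hM : 0 < M.card) (hMN : M.card = N.card)
    {S : (Fin (k + 2) → F) → (Fin (k + 2) → F)}
    (h : (gadget θ M).map (fun x => upToSign (S x)) = (gadget θ N).map upToSign)
    {x : Fin (k + 2) → F} (hx : x = extend θ 0 0 ∨ x = extend 0 θ 0) :
    upToSign (S x) = upToSign (extend θ 0 0) ∨ upToSign (S x) = upToSign (extend 0 θ 0) := by
  classical
  by_contra! hne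
  have h1 := count_map_upToSign_gadget_le θ N (S x) hne.1 hne.2
  rw [← h] at h1
  have h2 : (Multiset.replicate (4 * M.card) (upToSign (S x))) ≤
      (gadget θ M).map fun x => upToSign (S x) := by
    rw [← Multiset.map_replicate (fun x => upToSign (S x))]
    refine Multiset.map_le_map ?_
    rcases hx with rfl | rfl
    · exact (Multiset.le_add_left _ _).trans (Multiset.le_add_right _ _)
    · exact Multiset.le_add_left _ _
  have h3 := Multiset.count_le_of_le (upToSign (S x)) h2
  rw [Multiset.count_replicate_self] at h3
  -- The class would occur at least `4 * M.card` and at most `3 * N.card` times; the cardinalities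
  -- are equal and positive.
  omega

theorem upToSign_extend_ne {a b c d : F} (h1 : ¬(a = c ∧ b = d)) (h2 : ¬(a = -c ∧ b = -d))
    (v w : Fin k → F) : upToSign (extend c d v) ≠ upToSign (extend a b w) := by
  intro h
  rw [eq_comm, upToSign_eq_iff, extend_neg, extend_inj, extend_inj] at h
  tauto

theorem count_map_upToSign_extend_of_ne [DecidableEq F] {a b c d : F} (h1 : ¬(a = c ∧ b = d))
    (h2 : ¬(a = -c ∧ b = -d)) (w : Fin k → F) (T : Multiset (Fin k → F)) :
    (T.map fun v => upToSign (extend c d v)).count (upToSign (extend a b w)) = 0 := by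
  rw [Multiset.count_eq_zero, Multiset.mem_map]
  rintro ⟨v, -, hv⟩
  exact upToSign_extend_ne h1 h2 v w hv

theorem count_map_upToSign_extend [DecidableEq F] {a b : F} (hab : a ≠ 0 ∨ b ≠ 0) (w : Fin k → F)
    (T : Multiset (Fin k → F)) :
    (T.map fun v => upToSign (extend a b v)).count (upToSign (extend a b w)) = T.count w :=
  Multiset.count_map_eq_count' (fun v => upToSign (extend a b v)) T
    (fun _ _ h => (upToSign_extend_inj hab).1 h) w

/-- The two possible positions of the images `(a, b)` and `(a', b')` of the two pins. -/
def PinImages (θ a b a' b' : F) : Prop :=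
  (a = θ ∧ b = 0 ∧ a' = 0 ∧ (b' = θ ∨ b' = -θ)) ∨ (a = 0 ∧ b = θ ∧ b' = 0 ∧ (a' = θ ∨ a' = -θ))

/-- The core of the converse: once the pins are located, the compression of `S` to the last `k`
coordinates is the required automorphism. The sign of the second pin may stay undetermined, since
only columns attached to the first pin are counted. -/
theorem exists_linearEquiv_of_pinImages {θ : F} (hθ : θ ≠ 0) {M N : Multiset (Fin k → F)}
    (hMN : M.card = N.card) (S : (Fin (k + 2) → F) ≃ₗ[F] (Fin (k + 2) → F))
    (h : (gadget θ M).map (fun x => upToSign (S x)) = (gadget θ N).map upToSign)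
    {a b a' b' : F} (hp : PinImages θ a b a' b') (h1 : S (extend θ 0 0) = extend a b 0)
    (h2 : S (extend 0 θ 0) = extend a' b' 0) :
    ∃ A : (Fin k → F) ≃ₗ[F] (Fin k → F), M.map A = N := by
  classical
  have hmem : ∀ y ∈ gadget θ M, S y 0 * S y 1 = 0 := by
    intro y hy
    have hy' : upToSign (S y) ∈ (gadget θ N).map upToSign :=
      h ▸ Multiset.mem_map_of_mem (fun x => upToSign (S x)) hy
    obtain ⟨z, hz, hzy⟩ := Multiset.mem_map.1 hy'
    have hz0 := mem_gadget hz
    rcases upToSign_eq_iff.1 hzy with rfl | rfl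
    · exact hz0
    · simpa using hz0
  have hsplit : ∀ c d : F, ∀ v : Fin k → F,
      extend c d v = extend 0 0 v + ((c / θ) • extend θ 0 0 + (d / θ) • extend 0 θ 0) := by
    intro c d v
    simp only [extend_smul, extend_add, extend_inj, smul_zero, mul_zero, zero_add, add_zero]
    exact ⟨by field_simp, by field_simp, trivial⟩
  have hS : ∀ c d : F, ∀ v : Fin k → F, S (extend c d v) =
      S (extend 0 0 v) + ((c / θ) • extend a b 0 + (d / θ) • extend a' b' 0) := by
    intro c d v
    rw [hsplit, map_add, map_add, map_smul, map_smul, h1, h2]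
  have htop : ∀ g ∈ M, S (extend 0 0 g) 0 = 0 ∧ S (extend 0 0 g) 1 = 0 := by
    intro g hg
    have m0 := hmem (extend 0 0 g) (by simp [gadget, extend_inj, hg])
    have m1 := hmem (extend θ 0 g) (by simp [gadget, extend_inj, hg])
    have m2 := hmem (extend 0 θ g) (by simp [gadget, extend_inj, hg])
    rw [hS θ 0] at m1
    rw [hS 0 θ] at m2
    simp only [div_self hθ, one_smul, zero_div, zero_smul, add_zero, zero_add, Pi.add_apply,
      extend_zero, extend_one] at m1 m2
    generalize S (extend 0 0 g) 0 = x at *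
    generalize S (extend 0 0 g) 1 = y at *
    -- Subtracting `x * y = 0` from the product conditions for the shifted columns leaves linear
    -- equations. As each pin image lies on one axis, they say `θ * x = 0` and `θ * y = 0` up to
    -- sign and order.
    have e1 : x * b' + a' * y + a' * b' = 0 := by linear_combination m2 - m0
    have e2 : x * b + a * y + a * b = 0 := by linear_combination m1 - m0
    rcases hp with ⟨rfl, rfl, rfl, rfl | rfl⟩ | ⟨rfl, rfl, rfl, rfl | rfl⟩ <;>
      simp only [mul_zero, zero_mul, zero_add, add_zero, mul_neg, neg_mul, neg_zero, neg_eq_zero,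
        mul_eq_zero, hθ, or_false, false_or] at e1 e2 <;>
      exact ⟨by assumption, by assumption⟩
  set A : (Fin k → F) →ₗ[F] (Fin k → F) :=
    { toFun := fun v i => S (extend 0 0 v) i.succ.succ
      map_add' := fun v w => by
        have : extend 0 0 (v + w) = extend (0 : F) 0 v + extend 0 0 w := by
          rw [extend_add, add_zero]
        rw [this, map_add]; rfl
      map_smul' := fun c v => by
        have : extend 0 0 (c • v) = c • extend (0 : F) 0 v := by rw [extend_smul, mul_zero]
        rw [this, map_smul]; rfl }
  have hSA : ∀ g ∈ M, S (extend 0 0 g) = extend 0 0 (A g) := by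
    intro g hg
    rw [← extend_eta (S (extend 0 0 g)), (htop g hg).1, (htop g hg).2]
    rfl
  -- The columns in `M` need not span, so `htop` is not available for an arbitrary `v`. Instead, if
  -- `A v = 0` then `S (extend 0 0 v)` lies in the plane of the two top coordinates, which the pin
  -- images span; injectivity of `S` puts `extend 0 0 v` in the span of the pins, whence `v = 0`.
  have hinj : Function.Injective A := by
    rw [← LinearMap.ker_eq_bot, LinearMap.ker_eq_bot']
    intro v hv
    set s := S (extend 0 0 v) 0
    set t := S (extend 0 0 v) 1
    have hst : S (extend 0 0 v) = extend s t 0 := by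
      rw [← extend_eta (S (extend 0 0 v)), extend_inj]
      exact ⟨rfl, rfl, hv⟩
    have hS0 : ∀ α β : F, S (extend α β 0) =
        extend (α / θ * a + β / θ * a') (α / θ * b + β / θ * b') 0 := by
      intro α β
      have : extend α β (0 : Fin k → F) = (α / θ) • extend θ 0 0 + (β / θ) • extend 0 θ 0 := by
        simp only [extend_smul, extend_add, extend_inj, smul_zero, mul_zero, zero_add, add_zero]
        exact ⟨by field_simp, by field_simp, trivial⟩
      rw [this, map_add, map_smul, map_smul, h1, h2, extend_smul, extend_smul, extend_add,
        smul_zero, smul_zero, add_zero]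
    obtain ⟨α, β, hαβ⟩ : ∃ α β : F, extend s t 0 = S (extend α β (0 : Fin k → F)) := by
      simp only [hS0, extend_inj, and_true]
      rcases hp with ⟨rfl, rfl, rfl, rfl | rfl⟩ | ⟨rfl, rfl, rfl, rfl | rfl⟩
      · exact ⟨s, t, by simp [hθ], by simp [hθ]⟩
      · exact ⟨s, -t, by simp [hθ], by simp [hθ]⟩
      · exact ⟨t, s, by simp [hθ], by simp [hθ]⟩
      · exact ⟨t, -s, by simp [hθ], by simp [hθ]⟩
    exact (extend_inj.1 (S.injective (hst.trans hαβ))).2.2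
  refine ⟨LinearEquiv.ofInjectiveEndo A hinj, ?_⟩
  rw [LinearEquiv.coe_ofInjectiveEndo]
  have hab : a ≠ 0 ∨ b ≠ 0 := by
    rcases hp with ⟨rfl, -⟩ | ⟨-, rfl, -⟩
    exacts [Or.inl hθ, Or.inr hθ]
  have hL : (gadget θ M).map (fun x => upToSign (S x)) =
      ((M.map A).map fun v => upToSign (extend 0 0 v)) +
      ((M.map A).map fun v => upToSign (extend a b v)) +
      ((M.map A).map fun v => upToSign (extend a' b' v)) +
      Multiset.replicate (4 * M.card) (upToSign (extend a b 0)) +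
      Multiset.replicate (4 * M.card) (upToSign (extend a' b' 0)) := by
    simp only [gadget, Multiset.map_add, Multiset.map_map, Multiset.map_replicate, h1, h2]
    congr 3
    · congr 1
      · exact Multiset.map_congr rfl fun g hg => by simp [hSA g hg]
      · refine Multiset.map_congr rfl fun g hg => ?_
        simp only [Function.comp_apply]
        rw [hS, hSA g hg, div_self hθ, one_smul, zero_div, zero_smul, add_zero, extend_add,
          zero_add, zero_add, add_zero]
    · refine Multiset.map_congr rfl fun g hg => ?_
      simp only [Function.comp_apply]
      rw [hS, hSA g hg, div_self hθ, one_smul, zero_div, zero_smul, zero_add, extend_add,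
        zero_add, zero_add, add_zero]
  have hR : (gadget θ N).map upToSign =
      (N.map fun v => upToSign (extend 0 0 v)) + (N.map fun v => upToSign (extend θ 0 v)) +
      (N.map fun v => upToSign (extend 0 θ v)) +
      Multiset.replicate (4 * N.card) (upToSign (extend θ 0 0)) +
      Multiset.replicate (4 * N.card) (upToSign (extend 0 θ 0)) := by
    simp only [gadget, Multiset.map_add, Multiset.map_map, Multiset.map_replicate,
      Function.comp_def]
  rw [hL, hR] at h
  ext w
  -- In this class, only the family with top `(a, b)` and its pin count on either side. The pin
  -- terms agree, which leaves the multiplicities of `w` in `M.map A` and in `N`.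
  have hw := congrArg (Multiset.count (upToSign (extend a b w))) h
  simp only [Multiset.count_add, Multiset.count_replicate,
    count_map_upToSign_extend hab, hMN] at hw
  have n0 : ¬(a = 0 ∧ b = 0) := by tauto
  have n0' : ¬(a = -0 ∧ b = -0) := by simpa using n0
  have n1 : ¬(a = a' ∧ b = b') := by
    rcases hp with ⟨rfl, rfl, rfl, -⟩ | ⟨rfl, rfl, rfl, -⟩ <;> simp [hθ]
  have n1' : ¬(a = -a' ∧ b = -b') := by
    rcases hp with ⟨rfl, rfl, rfl, -⟩ | ⟨rfl, rfl, rfl, -⟩ <;> simp [hθ]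
  rw [count_map_upToSign_extend_of_ne n0 n0', count_map_upToSign_extend_of_ne n0 n0',
    count_map_upToSign_extend_of_ne n1 n1', if_neg (upToSign_extend_ne n1 n1' 0 w)] at hw
  rcases hp with ⟨rfl, rfl, -⟩ | ⟨rfl, rfl, -⟩
  · have m : ¬(a = 0 ∧ 0 = a) := fun h => hθ h.1
    have m' : ¬(a = -0 ∧ 0 = -a) := fun h => hθ (h.1.trans neg_zero)
    rw [count_map_upToSign_extend (Or.inl hθ), count_map_upToSign_extend_of_ne m m',
      if_neg (upToSign_extend_ne m m' 0 w)] at hw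
    omega
  · have m : ¬(0 = b ∧ b = 0) := fun h => hθ h.2
    have m' : ¬(0 = -b ∧ b = -0) := fun h => hθ (h.2.trans neg_zero)
    rw [count_map_upToSign_extend (Or.inr hθ), count_map_upToSign_extend_of_ne m m',
      if_neg (upToSign_extend_ne m m' 0 w)] at hw
    omega

theorem exists_linearEquiv_of_gadget {θ : F} (hθ : θ ≠ 0) {M N : Multiset (Fin k → F)}
    (hM : 0 < M.card) (hMN : M.card = N.card) (S : (Fin (k + 2) → F) ≃ₗ[F] (Fin (k + 2) → F))
    (h : (gadget θ M).map (fun x => upToSign (S x)) = (gadget θ N).map upToSign) :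
    ∃ A : (Fin k → F) ≃ₗ[F] (Fin k → F), M.map A = N := by
  have key : ∀ S : (Fin (k + 2) → F) ≃ₗ[F] (Fin (k + 2) → F),
      (gadget θ M).map (fun x => upToSign (S x)) = (gadget θ N).map upToSign →
      S (extend θ 0 0) = extend θ 0 0 ∨ S (extend θ 0 0) = extend 0 θ 0 →
      ∃ A : (Fin k → F) ≃ₗ[F] (Fin k → F), M.map A = N := by
    intro S h h1
    -- The second pin cannot land on the first one's image up to sign, because the pins are linearly
    -- independent.
    have hne : ∀ x y : Fin (k + 2) → F, S (extend θ 0 0) = x → S (extend 0 θ 0) = y →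
        y ≠ x ∧ y ≠ -x := by
      rintro x y rfl rfl
      rw [← map_neg, extend_neg]
      exact ⟨fun h => hθ (extend_inj.1 (S.injective h)).1.symm,
        fun h => hθ (neg_eq_zero.1 (extend_inj.1 (S.injective h)).1.symm)⟩
    have h2 := map_pin_eq hM hMN h (Or.inr rfl)
    simp only [upToSign_eq_iff, extend_neg, neg_zero] at h2
    rcases h1 with h1 | h1
    · have := hne _ _ h1 rfl
      rw [extend_neg, neg_zero, neg_zero] at this
      rcases h2 with (h2 | h2) | (h2 | h2)
      · exact absurd h2 this.1
      · exact absurd h2 this.2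
      · exact exists_linearEquiv_of_pinImages hθ hMN S h (by simp [PinImages]) h1 h2
      · exact exists_linearEquiv_of_pinImages hθ hMN S h (by simp [PinImages]) h1 h2
    · have := hne _ _ h1 rfl
      rw [extend_neg, neg_zero, neg_zero] at this
      rcases h2 with (h2 | h2) | (h2 | h2)
      · exact exists_linearEquiv_of_pinImages hθ hMN S h (by simp [PinImages]) h1 h2
      · exact exists_linearEquiv_of_pinImages hθ hMN S h (by simp [PinImages]) h1 h2
      · exact absurd h2 this.1
      · exact absurd h2 this.2
  have h1 := map_pin_eq hM hMN h (Or.inl rfl)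
  simp only [upToSign_eq_iff] at h1
  rcases h1 with (h1 | h1) | (h1 | h1)
  · exact key S h (Or.inl h1)
  · exact key (S.trans (LinearEquiv.neg F)) (by simpa using h) (Or.inl (by simp [h1]))
  · exact key S h (Or.inr h1)
  · exact key (S.trans (LinearEquiv.neg F)) (by simpa using h) (Or.inr (by simp [h1]))

/-! ### The reduction on matrices -/

omit [Field F] in
theorem card_columns {n : ℕ} (A : Matrix (Fin k) (Fin n) F) : (columns A).card = n := by
  simp [columns]

/-- The matrix with a given list of columns. -/
def ofColumns {n : ℕ} (L : List (Fin k → F)) (h : L.length = n) : Matrix (Fin k) (Fin n) F :=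
  fun i j => L.get (j.cast h.symm) i

omit [Field F] in
theorem map_finRange_ofColumns {n : ℕ} (L : List (Fin k → F)) (h : L.length = n) :
    (List.finRange n).map (ofColumns L h).col = L := by
  subst h
  exact List.map_get_finRange L

omit [Field F] in
theorem columns_eq_coe {n : ℕ} (A : Matrix (Fin k) (Fin n) F) :
    columns A = ((List.finRange n).map A.col : List _) := by
  rw [columns, Fin.univ_def, Multiset.map_coe]

/-- The matrix in which the columns, in reverse order, are replaced by their blocks. -/
def reduceMatrix {n : ℕ} (θ : F) (A : Matrix (Fin k) (Fin n) F) :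
    Matrix (Fin (k + 2)) (Fin (11 * n)) F :=
  ofColumns (((List.finRange n).map A.col).reverse.flatMap (block θ))
    (by simp [List.length_flatMap, Function.comp_def, mul_comm])

theorem columns_reduceMatrix {n : ℕ} (θ : F) (A : Matrix (Fin k) (Fin n) F) :
    columns (reduceMatrix θ A) = gadget θ (columns A) := by
  rw [columns_eq_coe, reduceMatrix, map_finRange_ofColumns, coe_flatMap_block,
    Multiset.coe_reverse, ← columns_eq_coe]

theorem linearIndependent_row_iff {n : ℕ} (A : Matrix (Fin k) (Fin n) F) :
    LinearIndependent F A.row ↔ ∀ c : Fin k → F, (∀ v ∈ columns A, c ⬝ᵥ v = 0) → c = 0 := by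
  rw [← Matrix.vecMul_injective_iff]
  have : (∀ c : Fin k → F, (∀ v ∈ columns A, c ⬝ᵥ v = 0) → c = 0) ↔
      ∀ c : Fin k → F, Matrix.vecMulLinear A c = 0 → c = 0 := by
    refine forall_congr' fun c => imp_congr_left ?_
    rw [columns, funext_iff]
    simp only [Multiset.mem_map, Finset.mem_val, Finset.mem_univ, true_and, forall_exists_index,
      forall_apply_eq_imp_iff]
    rfl
  rw [this, ← LinearMap.ker_eq_bot', LinearMap.ker_eq_bot]
  rfl

theorem dotProduct_extend (c : Fin (k + 2) → F) (a b : F) (v : Fin k → F) :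
    c ⬝ᵥ extend a b v = c 0 * a + c 1 * b + (fun i => c i.succ.succ) ⬝ᵥ v := by
  simp only [dotProduct, Fin.sum_univ_succ (n := k + 1), Fin.sum_univ_succ (n := k)]
  rw [← add_assoc]
  rfl

/-- A relation among the rows annihilates every column: the pins kill its first two coefficients,
and the columns `(0,0,v)` turn the rest into a relation among the rows of `A`. -/
theorem linearIndependent_reduceMatrix {n : ℕ} (hn : 0 < n) {θ : F} (hθ : θ ≠ 0)
    {A : Matrix (Fin k) (Fin n) F} (h : LinearIndependent F A.row) :
    LinearIndependent F (reduceMatrix θ A).row := by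
  rw [linearIndependent_row_iff] at h ⊢
  intro c hc
  rw [columns_reduceMatrix] at hc
  have hcard := card_columns A
  have h0 : c 0 = 0 := by
    have := hc (extend θ 0 0) (by simp [gadget, Multiset.mem_replicate, hcard, hn.ne'])
    rw [dotProduct_extend] at this
    simpa [hθ] using this
  have h1 : c 1 = 0 := by
    have := hc (extend 0 θ 0) (by simp [gadget, Multiset.mem_replicate, hcard, hn.ne'])
    rw [dotProduct_extend] at this
    simpa [hθ] using this
  have h2 := h (fun i => c i.succ.succ) fun v hv => by
    have := hc (extend 0 0 v) (by simp [gadget, extend_inj, hv])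
    rw [dotProduct_extend] at this
    simpa using this
  rw [← extend_eta c, ← extend_eta (0 : Fin (k + 2) → F), extend_inj]
  exact ⟨h0, h1, h2⟩

/-- The reduction. -/
def reduce (θ : F) (x : MatrixPair F) : MatrixPair F where
  k := x.k + 2
  n := 11 * x.n
  k_pos := by omega
  n_pos := by have := x.n_pos; omega
  G := reduceMatrix θ x.H
  H := reduceMatrix θ x.G

/-- The reduction exchanges the two matrices, because the machine's output stack reverses their
order; hence the inverse automorphisms. -/
theorem pce_iff_spce_reduce {θ : F} (hθ : θ ≠ 0) (x : MatrixPair F) :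
    x.PCE ↔ (reduce θ x).SPCE := by
  rw [MatrixPair.pce_iff, MatrixPair.spce_iff]
  simp only [reduce, columns_reduceMatrix]
  constructor
  · rintro ⟨A, hA⟩
    refine ⟨extendEquiv A.symm, ?_⟩
    have h := map_extend_gadget θ (A.symm : (Fin x.k → F) →ₗ[F] (Fin x.k → F))
      (extendEquiv A.symm) (extendEquiv_extend A.symm) (columns x.H)
    have hA' : (columns x.H).map A.symm = columns x.G := by
      rw [← hA, Multiset.map_map]; simp
    rw [LinearEquiv.coe_coe, hA'] at h
    rw [← h, Multiset.map_map]
    rfl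
  · rintro ⟨S, hS⟩
    obtain ⟨A, hA⟩ := exists_linearEquiv_of_gadget hθ
      (by rw [card_columns]; exact x.n_pos) (by rw [card_columns, card_columns]) S hS
    refine ⟨A.symm, ?_⟩
    rw [← hA, Multiset.map_map]; simp

theorem isGeneratorPair_reduce {θ : F} (hθ : θ ≠ 0) {x : MatrixPair F} (h : x.IsGeneratorPair) :
    (reduce θ x).IsGeneratorPair :=
  ⟨linearIndependent_reduceMatrix x.n_pos hθ h.2, linearIndependent_reduceMatrix x.n_pos hθ h.1⟩

theorem MatrixPair.IsGeneratorPair.k_le_n {x : MatrixPair F} (h : x.IsGeneratorPair) :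
    x.k ≤ x.n := by
  simpa using h.1.fintype_card_le_finrank

end Gadget

/-! ### A stack machine that rewrites columns in linear time -/

section Machine

open Turing Turing.TM2

/-- The stacks of the machine. -/
inductive Stack (m : ℕ)
  | inp
  | out
  | fld
  | aux (j : Fin m)
  deriving DecidableEq, Fintype

/-- The labels of the machine. -/
inductive Label (m : ℕ)
  | header
  | read (b : Bool)
  | emit (b : Bool) (x : Symbol)
  | dump (i : Fin (m + 1))
  | finish
  deriving Fintype

/-- For each auxiliary stack, the word that is pushed on it for a symbol of a column. The flag is
`true` in the first entry of a column. -/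
abbrev Words (m : ℕ) := Fin m → Bool → Symbol → List Symbol

/-- The statements of the machine. -/
abbrev Statement (m : ℕ) := Stmt (fun _ : Stack m => Symbol) (Label m) (Option Symbol)

variable {m : ℕ}

/-- Push a word, its first symbol first. -/
def pushWord (k : Stack m) : List Symbol → Statement m → Statement m
  | [], q => q
  | x :: xs, q => Stmt.push k (fun _ => x) (pushWord k xs q)

/-- Push on each auxiliary stack its word for the symbol `x`. -/
def pushWords (w : Words m) (b : Bool) (x : Symbol) : List (Fin m) → Statement m → Statement m
  | [], q => q
  | j :: js, q => pushWord (Stack.aux j) (w j b x) (pushWords w b x js q)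

/-- Whether the next symbol still belongs to the first entry of the column. -/
def nextFlag : Bool → Symbol → Bool
  | _, Symbol.endEntry => false
  | b, _ => b

/-- Pop a symbol from a stack and push it on the output, until the stack is empty. -/
def moveToOutput (k : Stack m) (self : Label m) (q : Statement m) : Statement m :=
  Stmt.pop k (fun _ x => x) (Stmt.branch Option.isNone q
    (Stmt.push Stack.out (fun v => v.getD Symbol.endPart) (Stmt.goto fun _ => self)))

/-- The program: it sets the field aside, reads a column while writing on the auxiliary stacks,
empties these on the output, and goes on to the next column; the field comes last. -/
def program (w : Words m) : Label m → Statement m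
  | Label.header => Stmt.pop Stack.inp (fun _ x => x)
      (Stmt.branch (fun v => decide (v = some Symbol.endPart))
        (Stmt.push Stack.out (fun _ => Symbol.endPart) (Stmt.goto fun _ => Label.read true))
        (Stmt.push Stack.fld (fun v => v.getD Symbol.endPart) (Stmt.goto fun _ => Label.header)))
  | Label.read b => Stmt.pop Stack.inp (fun _ x => x)
      (Stmt.goto fun v => v.elim Label.finish (Label.emit b))
  | Label.emit _ Symbol.endPart =>
      Stmt.push Stack.out (fun _ => Symbol.endPart) (Stmt.goto fun _ => Label.read true)
  | Label.emit b Symbol.endColumn => pushWords w b Symbol.endColumn (List.finRange m)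
      (Stmt.goto fun _ => Label.dump (Fin.last m))
  | Label.emit b x => pushWords w b x (List.finRange m)
      (Stmt.goto fun _ => Label.read (nextFlag b x))
  | Label.dump i => Fin.cases (Stmt.goto fun _ => Label.read true)
      (fun i => moveToOutput (Stack.aux i) (Label.dump i.succ)
        (Stmt.goto fun _ => Label.dump i.castSucc)) i
  | Label.finish => moveToOutput Stack.fld Label.finish Stmt.halt

/-- The contents of the stacks. -/
def contents (i o f : List Symbol) (a : Fin m → List Symbol) : Stack m → List Symbol
  | Stack.inp => i
  | Stack.out => o
  | Stack.fld => f
  | Stack.aux j => a j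

section Stacks

variable (i o f l : List Symbol) (a : Fin m → List Symbol)

@[simp] theorem contents_inp : contents i o f a Stack.inp = i := rfl
@[simp] theorem contents_out : contents i o f a Stack.out = o := rfl
@[simp] theorem contents_fld : contents i o f a Stack.fld = f := rfl
@[simp] theorem contents_aux (j : Fin m) : contents i o f a (Stack.aux j) = a j := rfl

@[simp] theorem update_contents_inp :
    Function.update (contents i o f a) Stack.inp l = contents l o f a := by
  funext k; cases k <;> simp

@[simp] theorem update_contents_out :
    Function.update (contents i o f a) Stack.out l = contents i l f a := by
  funext k; cases k <;> simp

@[simp] theorem update_contents_fld :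
    Function.update (contents i o f a) Stack.fld l = contents i o l a := by
  funext k; cases k <;> simp

@[simp] theorem update_contents_aux (j : Fin m) :
    Function.update (contents i o f a) (Stack.aux j) l =
      contents i o f (Function.update a j l) := by
  funext k; cases k <;> simp [Function.update_apply]

end Stacks

/-- The configurations of the machine. -/
abbrev Config (m : ℕ) := Cfg (fun _ : Stack m => Symbol) (Label m) (Option Symbol)

/-- The machine gets from `c` to `c'` in at most `t` steps. -/
def Runs (w : Words m) (c : Config m) (t : ℕ) (c' : Config m) : Prop :=
  Nonempty (StateTransition.EvalsToInTime (step (program w)) c (some c') t)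

namespace Runs

variable {w : Words m} {c c' c'' : Config m} {s t : ℕ}

theorem trans (h : Runs w c s c') (h' : Runs w c' t c'') : Runs w c (s + t) c'' := by
  obtain ⟨h⟩ := h
  obtain ⟨h'⟩ := h'
  rw [add_comm]
  exact ⟨h.trans _ _ _ _ _ _ h'⟩

theorem mono (h : Runs w c s c') (hst : s ≤ t) : Runs w c t c' := by
  obtain ⟨h⟩ := h
  exact ⟨⟨h.toEvalsTo, h.steps_le_m.trans hst⟩⟩

theorem refl : Runs w c 0 c := ⟨StateTransition.EvalsToInTime.refl _ _⟩

theorem one (h : step (program w) c = some c') : Runs w c 1 c' :=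
  ⟨⟨⟨1, h⟩, le_rfl⟩⟩

end Runs

variable (w : Words m)

theorem runs_header (v : Option Symbol) (p i o f : List Symbol) (a : Fin m → List Symbol)
    (hp : Symbol.endPart ∉ p) :
    Runs w ⟨some Label.header, v, contents (p ++ Symbol.endPart :: i) o f a⟩ (p.length + 1)
      ⟨some (Label.read true), some Symbol.endPart,
        contents i (Symbol.endPart :: o) (p.reverse ++ f) a⟩ := by
  induction p generalizing v f with
  | nil => exact Runs.one (by simp [program])
  | cons x p ih =>
    rw [List.mem_cons, not_or] at hp
    refine ((Runs.one ?_).trans (ih (some x) (x :: f) hp.2)).mono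
      (t := (x :: p).length + 1) (by simp; omega) |> fun h => by simpa using h
    simp [program, Ne.symm hp.1]

theorem runs_finish (v : Option Symbol) (i o f : List Symbol) (a : Fin m → List Symbol) :
    Runs w ⟨some Label.finish, v, contents i o f a⟩ (f.length + 1)
      ⟨none, none, contents i (f.reverse ++ o) [] a⟩ := by
  induction f generalizing v o with
  | nil => exact Runs.one (by simp [program, moveToOutput])
  | cons x f ih =>
    have h1 : Runs w ⟨some Label.finish, v, contents i o (x :: f) a⟩ 1
        ⟨some Label.finish, some x, contents i (x :: o) f a⟩ :=
      Runs.one (by simp [program, moveToOutput])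
    have := h1.trans (ih (some x) (x :: o))
    rw [List.length_cons, List.reverse_cons, List.append_assoc]
    exact this.mono (by omega)

theorem runs_dump_one (n : Fin m) (v : Option Symbol) (i o f l : List Symbol)
    (a : Fin m → List Symbol) (hl : a n = l) :
    Runs w ⟨some (Label.dump n.succ), v, contents i o f a⟩ (l.length + 1)
      ⟨some (Label.dump n.castSucc), none,
        contents i (l.reverse ++ o) f (Function.update a n [])⟩ := by
  induction l generalizing v o a with
  | nil => exact Runs.one (by simp [program, moveToOutput, hl])
  | cons x l ih =>
    have h1 : Runs w ⟨some (Label.dump n.succ), v, contents i o f a⟩ 1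
        ⟨some (Label.dump n.succ), some x, contents i (x :: o) f (Function.update a n l)⟩ :=
      Runs.one (by simp [program, moveToOutput, hl])
    have := h1.trans (ih (some x) (x :: o) (Function.update a n l) (by simp))
    rw [Function.update_idem] at this
    rw [List.length_cons, List.reverse_cons, List.append_assoc]
    exact this.mono (by omega)

/-- Stacks are emptied from the highest index down, so that the word of stack `0` ends on top of the
output. Each takes at most `s` moves and one pop that finds it empty; the final `1` is the jump back
to reading. -/
theorem runs_dump_prefix (s : ℕ) (n : ℕ) (hn : n ≤ m) (v : Option Symbol) (i o f : List Symbol)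
    (a : Fin m → List Symbol) (ha : ∀ j, (a j).length ≤ s) (ha' : ∀ j : Fin m, n ≤ j → a j = []) :
    ∃ v', Runs w ⟨some (Label.dump ⟨n, Nat.lt_succ_of_le hn⟩), v, contents i o f a⟩
      (n * (s + 1) + 1)
      ⟨some (Label.read true), v', contents i
        ((List.ofFn fun j : Fin n => (a (j.castLE hn)).reverse).flatten ++ o) f fun _ => []⟩ := by
  induction n generalizing v o a with
  | zero =>
    have : a = fun _ => [] := funext fun j => ha' j (Nat.zero_le _)
    exact ⟨v, (Runs.one (by simp [program, this])).mono (by omega)⟩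
  | succ n ih =>
    have h1 := runs_dump_one w ⟨n, hn⟩ v i o f _ a rfl
    obtain ⟨v', h2⟩ := ih (by omega) none ((a ⟨n, hn⟩).reverse ++ o)
      (Function.update a ⟨n, hn⟩ []) (fun j => by
        rw [Function.update_apply]
        split_ifs
        exacts [Nat.zero_le _, ha j]) (fun j hj => by
        rw [Function.update_apply]
        split_ifs with h
        · rfl
        · refine ha' j (Nat.succ_le_of_lt (lt_of_le_of_ne hj fun h' => h (Fin.ext h'.symm))))
    refine ⟨v', ?_⟩
    have h3 := h1.trans h2
    have hlen := ha ⟨n, hn⟩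
    rw [List.ofFn_succ', List.concat_eq_append, List.flatten_append, List.append_assoc]
    have h4 : (List.ofFn fun j : Fin n =>
        (Function.update a ⟨n, hn⟩ [] (j.castLE (by omega))).reverse) =
        List.ofFn fun j : Fin n => (a ((j.castSucc).castLE hn)).reverse := by
      congr 1
      funext j
      rw [Function.update_of_ne]
      · rfl
      · intro h
        have := congrArg Fin.val h
        simp at this
        omega
    rw [h4] at h3
    simp only [List.flatten_cons, List.flatten_nil, List.append_nil]
    refine h3.mono ?_
    rw [add_mul]; omega

/-- All the words that are pushed for a string of symbols, put together. -/
def transduce (w : Bool → Symbol → List Symbol) : Bool → List Symbol → List Symbol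
  | _, [] => []
  | b, x :: xs => w b x ++ transduce w (nextFlag b x) xs

theorem stepAux_pushWord (j : Fin m) (l : List Symbol) (q : Statement m) (v : Option Symbol)
    (i o f : List Symbol) (a : Fin m → List Symbol) :
    stepAux (pushWord (Stack.aux j) l q) v (contents i o f a) =
      stepAux q v (contents i o f (Function.update a j (l.reverse ++ a j))) := by
  induction l generalizing a with
  | nil => simp [pushWord]
  | cons x l ih => simp [pushWord, ih]

/-- All these pushes belong to a single machine step. Every stack is treated once, as the list of
indices has no duplicates. -/
theorem stepAux_pushWords (b : Bool) (x : Symbol) (q : Statement m) (v : Option Symbol)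
    (i o f : List Symbol) (a : Fin m → List Symbol) :
    stepAux (pushWords w b x (List.finRange m) q) v (contents i o f a) =
      stepAux q v (contents i o f fun j => (w j b x).reverse ++ a j) := by
  have key : ∀ (js : List (Fin m)) (a : Fin m → List Symbol), js.Nodup →
      stepAux (pushWords w b x js q) v (contents i o f a) = stepAux q v (contents i o f fun j =>
        if j ∈ js then (w j b x).reverse ++ a j else a j) := by
    intro js
    induction js with
    | nil => intro a _; simp [pushWords]
    | cons j js ih =>
      intro a hj
      rw [List.nodup_cons] at hj
      rw [pushWords, stepAux_pushWord, ih _ hj.2]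
      congr 2
      funext j'
      by_cases h : j' = j
      · subst h; simp [hj.1]
      · simp [h]
  rw [key _ _ (List.nodup_finRange m)]
  simp

theorem runs_read_symbol (b : Bool) (x : Symbol) (h1 : x ≠ Symbol.endColumn)
    (h2 : x ≠ Symbol.endPart) (v : Option Symbol) (i o f : List Symbol) (a : Fin m → List Symbol) :
    Runs w ⟨some (Label.read b), v, contents (x :: i) o f a⟩ 2
      ⟨some (Label.read (nextFlag b x)), some x,
        contents i o f fun j => (w j b x).reverse ++ a j⟩ := by
  have s1 : Runs w ⟨some (Label.read b), v, contents (x :: i) o f a⟩ 1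
      ⟨some (Label.emit b x), some x, contents i o f a⟩ := Runs.one (by simp [program])
  refine s1.trans (Runs.one ?_)
  cases x <;> first | contradiction | simp [program, stepAux_pushWords]

theorem runs_read_column (c : List Symbol) (h1 : Symbol.endColumn ∉ c) (h2 : Symbol.endPart ∉ c)
    (b : Bool) (v : Option Symbol) (i o f : List Symbol) (a : Fin m → List Symbol) :
    Runs w ⟨some (Label.read b), v, contents (c ++ Symbol.endColumn :: i) o f a⟩ (2 * (c.length + 1))
      ⟨some (Label.dump (Fin.last m)), some Symbol.endColumn, contents i o f fun j =>
        (transduce (w j) b (c ++ [Symbol.endColumn])).reverse ++ a j⟩ := by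
  induction c generalizing b v a with
  | nil =>
    have s1 : Runs w ⟨some (Label.read b), v, contents (Symbol.endColumn :: i) o f a⟩ 1
        ⟨some (Label.emit b Symbol.endColumn), some Symbol.endColumn, contents i o f a⟩ :=
      Runs.one (by simp [program])
    exact s1.trans (Runs.one (by simp [program, stepAux_pushWords, transduce]))
  | cons x c ih =>
    rw [List.mem_cons, not_or] at h1 h2
    have s1 := runs_read_symbol w b x (Ne.symm h1.1) (Ne.symm h2.1) v
      (c ++ Symbol.endColumn :: i) o f a
    have := s1.trans (ih h1.2 h2.2 _ _ _)
    simp only [List.cons_append, transduce, List.reverse_append, List.append_assoc] at this ⊢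
    exact this.mono (by simp; omega)

/-- What the machine makes of a column. -/
def columnOutput (c : List Symbol) : List Symbol :=
  (List.ofFn fun j => transduce (w j) true (c ++ [Symbol.endColumn])).flatten

theorem length_transduce_le (w : Bool → Symbol → List Symbol) (hw : ∀ b x, (w b x).length ≤ 2)
    (b : Bool) (c : List Symbol) : (transduce w b c).length ≤ 2 * c.length := by
  induction c generalizing b with
  | nil => simp [transduce]
  | cons x c ih =>
    have h1 := hw b x
    have h2 := ih (nextFlag b x)
    simp only [transduce, List.length_append, List.length_cons]
    omega

/-- With `L = c.length + 1`, reading costs `2 * L` and each of the `m` stacks costs at most `2 * L +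
1` to empty. Stacking the words and unstacking them again restores their order. -/
theorem runs_column (hw : ∀ j b x, (w j b x).length ≤ 2) (c : List Symbol)
    (h1 : Symbol.endColumn ∉ c) (h2 : Symbol.endPart ∉ c) (v : Option Symbol)
    (i o f : List Symbol) :
    ∃ v', Runs w ⟨some (Label.read true), v,
        contents (c ++ Symbol.endColumn :: i) o f fun _ => []⟩ ((3 * m + 3) * (c.length + 1))
      ⟨some (Label.read true), v', contents i (columnOutput w c ++ o) f fun _ => []⟩ := by
  have s1 := runs_read_column w c h1 h2 true v i o f fun _ => []
  obtain ⟨v', s2⟩ := runs_dump_prefix w (2 * (c.length + 1)) m le_rfl (some Symbol.endColumn) i o f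
    (fun j => (transduce (w j) true (c ++ [Symbol.endColumn])).reverse ++ [])
    (fun j => by
      simpa using length_transduce_le (w j) (hw j) true (c ++ [Symbol.endColumn]))
    (fun j hj => absurd j.2 (by omega))
  refine ⟨v', ?_⟩
  have s3 := s1.trans s2
  simp only [List.append_nil, List.reverse_reverse, Fin.castLE_rfl] at s3
  refine s3.mono ?_
  nlinarith

theorem runs_matrix (hw : ∀ j b x, (w j b x).length ≤ 2) (cs : List (List Symbol))
    (h : ∀ c ∈ cs, Symbol.endColumn ∉ c ∧ Symbol.endPart ∉ c) (v : Option Symbol)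
    (i o f : List Symbol) :
    ∃ v', Runs w ⟨some (Label.read true), v, contents
        (cs.flatMap (fun c => c ++ [Symbol.endColumn]) ++ Symbol.endPart :: i) o f fun _ => []⟩
      ((3 * m + 3) * ((cs.flatMap fun c => c ++ [Symbol.endColumn]).length + 1))
      ⟨some (Label.read true), v', contents i
        (Symbol.endPart :: (cs.reverse.flatMap (columnOutput w) ++ o)) f fun _ => []⟩ := by
  induction cs generalizing v o with
  | nil =>
    have s1 : Runs w ⟨some (Label.read true), v, contents (Symbol.endPart :: i) o f fun _ => []⟩ 1
        ⟨some (Label.emit true Symbol.endPart), some Symbol.endPart,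
          contents i o f fun _ => []⟩ := Runs.one (by simp [program])
    refine ⟨some Symbol.endPart, (s1.trans (Runs.one ?_)).mono ?_⟩
    · simp [program]
    · simp
  | cons c cs ih =>
    obtain ⟨hc, hcs⟩ := List.forall_mem_cons.1 h
    obtain ⟨v1, s1⟩ := runs_column w hw c hc.1 hc.2 v
      (cs.flatMap (fun c => c ++ [Symbol.endColumn]) ++ Symbol.endPart :: i) o f
    obtain ⟨v2, s2⟩ := ih hcs v1 (columnOutput w c ++ o)
    refine ⟨v2, ?_⟩
    have s3 := s1.trans s2
    simp only [List.flatMap_cons, List.reverse_cons, List.flatMap_append, List.flatMap_nil,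
      List.append_nil, List.append_assoc, List.cons_append, List.nil_append] at s3 ⊢
    refine s3.mono ?_
    simp only [List.length_append, List.length_cons]
    nlinarith

/-- The output grows from its end to its beginning, so a terminator pushed after reading one part
closes the part placed on top of it later: the one of the field closes the first matrix, that one's
closes the second matrix, and the last closes the field. -/
theorem runs_instance (hw : ∀ j b x, (w j b x).length ≤ 2) (p : List Symbol)
    (hp : Symbol.endPart ∉ p) (cs ds : List (List Symbol))
    (hcs : ∀ c ∈ cs, Symbol.endColumn ∉ c ∧ Symbol.endPart ∉ c)
    (hds : ∀ c ∈ ds, Symbol.endColumn ∉ c ∧ Symbol.endPart ∉ c) :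
    Runs w ⟨some Label.header, none, contents ((p ++ [Symbol.endPart]) ++
        (cs.flatMap (fun c => c ++ [Symbol.endColumn]) ++ [Symbol.endPart]) ++
        (ds.flatMap (fun c => c ++ [Symbol.endColumn]) ++ [Symbol.endPart])) [] [] fun _ => []⟩
      ((3 * m + 5) * ((p ++ [Symbol.endPart]) ++
        (cs.flatMap (fun c => c ++ [Symbol.endColumn]) ++ [Symbol.endPart]) ++
        (ds.flatMap (fun c => c ++ [Symbol.endColumn]) ++ [Symbol.endPart])).length)
      ⟨none, none, contents [] ((p ++ [Symbol.endPart]) ++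
        (ds.reverse.flatMap (columnOutput w) ++ [Symbol.endPart]) ++
        (cs.reverse.flatMap (columnOutput w) ++ [Symbol.endPart])) [] fun _ => []⟩ := by
  have s1 := runs_header w none p
    (cs.flatMap (fun c => c ++ [Symbol.endColumn]) ++ (Symbol.endPart ::
      (ds.flatMap (fun c => c ++ [Symbol.endColumn]) ++ [Symbol.endPart]))) [] [] (fun _ => []) hp
  obtain ⟨v2, s2⟩ := runs_matrix w hw cs hcs (some Symbol.endPart)
    (ds.flatMap (fun c => c ++ [Symbol.endColumn]) ++ [Symbol.endPart]) [Symbol.endPart]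
    (p.reverse ++ [])
  obtain ⟨v3, s3⟩ := runs_matrix w hw ds hds v2 []
    (Symbol.endPart :: (cs.reverse.flatMap (columnOutput w) ++ [Symbol.endPart])) (p.reverse ++ [])
  set o := Symbol.endPart :: (ds.reverse.flatMap (columnOutput w) ++
    Symbol.endPart :: (cs.reverse.flatMap (columnOutput w) ++ [Symbol.endPart])) with ho
  have s4 : Runs w ⟨some (Label.read true), v3, contents [] o (p.reverse ++ []) fun _ => []⟩ 1
      ⟨some Label.finish, none, contents [] o (p.reverse ++ []) fun _ => []⟩ :=
    Runs.one (by simp [program])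
  have s5 := runs_finish w none [] o (p.reverse ++ []) fun _ => []
  have s6 := (((s1.trans s2).trans s3).trans s4).trans s5
  simp only [ho, List.append_nil, List.reverse_reverse, List.append_assoc, List.cons_append,
    List.nil_append] at s6 ⊢
  refine s6.mono ?_
  simp only [List.length_append, List.length_cons, List.length_nil, List.length_reverse]
  nlinarith

/-- The bundled machine. -/
def machine : TM2ComputableAux Symbol Symbol where
  tm :=
    { K := Stack m
      k₀ := Stack.inp
      k₁ := Stack.out
      Γ := fun _ => Symbol
      Λ := Label m
      main := Label.header
      σ := Option Symbol
      initialState := none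
      Γk₀Fin := inferInstanceAs (Fintype Symbol)
      m := program w }
  inputAlphabet := Equiv.refl _
  outputAlphabet := Equiv.refl _

theorem outputsWithin_machine {input output : List Symbol} {t : ℕ}
    (h : Runs w ⟨some Label.header, none, contents input [] [] fun _ => []⟩ t
      ⟨none, none, contents [] output [] fun _ => []⟩) :
    OutputsWithin (machine w) input output t := by
  have h1 : initList (machine w).tm (input.map (machine w).inputAlphabet.invFun) =
      (⟨some Label.header, none, contents input [] [] fun _ => []⟩ : Config m) := by
    have : input.map (machine w).inputAlphabet.invFun = input := List.map_id _
    rw [this]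
    simp only [initList]
    congr 1
    funext k
    cases k <;> rfl
  have h2 : haltList (machine w).tm (output.map (machine w).outputAlphabet.invFun) =
      (⟨none, none, contents [] output [] fun _ => []⟩ : Config m) := by
    have : output.map (machine w).outputAlphabet.invFun = output := List.map_id _
    rw [this]
    simp only [haltList]
    congr 1
    funext k
    cases k <;> rfl
  unfold OutputsWithin TM2OutputsInTime
  rw [h1, Option.map_some, h2]
  exact h

end Machine

/-! ### The machine's rewriting rules produce the gadget -/

section Translation

/-- The four ways in which the machine rewrites a column on its auxiliary stacks: it copies the
column, writes a zero for every entry, or writes a single entry that is zero or has all of its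
coefficients equal to one. -/
inductive Rewriting
  | copy
  | zeros
  | headZero
  | headOne

/-- Replace every number by `0`. -/
def zeroNumbers : Symbol → List Symbol
  | Symbol.bit _ => []
  | x => [x]

/-- Replace every number by `1`. -/
def oneNumbers : Symbol → List Symbol
  | Symbol.bit _ => []
  | Symbol.endNumber => [Symbol.bit true, Symbol.endNumber]
  | x => [x]

/-- Keep only the first entry of a column, rewritten by `g`. -/
def onHead (g : Symbol → List Symbol) : Bool → Symbol → List Symbol
  | false, _ => []
  | true, Symbol.endColumn => []
  | true, x => g x

/-- The word written for a symbol. -/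
def Rewriting.word : Rewriting → Bool → Symbol → List Symbol
  | copy => fun _ x => [x]
  | zeros => fun _ x => zeroNumbers x
  | headZero => onHead zeroNumbers
  | headOne => onHead oneNumbers

/-- What is written on the auxiliary stacks, three of them for each column of a block. -/
def rewritings : List Rewriting :=
  [.headZero, .headZero, .copy, .headOne, .headZero, .copy, .headZero, .headOne, .copy] ++
    (List.replicate 4 [.headOne, .headZero, .zeros]).flatten ++
    (List.replicate 4 [.headZero, .headOne, .zeros]).flatten

/-- The words that compute the reduction. -/
def reductionWords : Words rewritings.length := fun j => (rewritings.get j).word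

theorem length_reductionWords_le (j : Fin rewritings.length) (b : Bool) (x : Symbol) :
    (reductionWords j b x).length ≤ 2 := by
  unfold reductionWords
  generalize rewritings.get j = K
  cases K <;> cases b <;> cases x <;> simp [Rewriting.word, onHead, zeroNumbers, oneNumbers]

theorem columnOutput_reductionWords (c : List Symbol) : columnOutput reductionWords c =
    rewritings.flatMap fun K => transduce K.word true (c ++ [Symbol.endColumn]) := by
  have h : (List.ofFn fun j : Fin rewritings.length =>
      transduce (rewritings.get j).word true (c ++ [Symbol.endColumn])) =
      (List.ofFn rewritings.get).map fun K => transduce K.word true (c ++ [Symbol.endColumn]) := by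
    rw [List.map_ofFn]; rfl
  rw [List.ofFn_get] at h
  rw [List.flatMap_def, ← h]
  rfl

theorem transduce_const (g : Symbol → List Symbol) (b : Bool) (c : List Symbol) :
    transduce (fun _ => g) b c = c.flatMap g := by
  induction c generalizing b with
  | nil => rfl
  | cons x c ih => rw [transduce, ih, List.flatMap_cons]

theorem transduce_onHead_false (g : Symbol → List Symbol) (c : List Symbol) :
    transduce (onHead g) false c = [] := by
  induction c with
  | nil => rfl
  | cons x c ih =>
    have : nextFlag false x = false := by cases x <;> rfl
    rw [transduce, this, ih]; rfl

theorem transduce_onHead (g : Symbol → List Symbol) (s c : List Symbol)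
    (hs : ∀ x ∈ s, x ≠ Symbol.endEntry ∧ x ≠ Symbol.endColumn) :
    transduce (onHead g) true (s ++ Symbol.endEntry :: c) =
      (s ++ [Symbol.endEntry]).flatMap g := by
  induction s with
  | nil => simp [transduce, nextFlag, transduce_onHead_false, onHead]
  | cons x s ih =>
    obtain ⟨hx, hs⟩ := List.forall_mem_cons.1 hs
    have h1 : nextFlag true x = true := by cases x <;> first | rfl | simp at hx
    have h2 : onHead g true x = g x := by cases x <;> first | rfl | simp at hx
    rw [List.cons_append, transduce, h1, ih hs, h2]
    simp

theorem flatMap_encodeNumber_zeroNumbers (a : ℕ) :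
    (encodeNumber a).flatMap zeroNumbers = encodeNumber 0 := by
  simp [encodeNumber, List.flatMap_map, zeroNumbers, Computability.encodeNat,
    Computability.encodeNum]

theorem flatMap_encodeNumber_oneNumbers (a : ℕ) :
    (encodeNumber a).flatMap oneNumbers = encodeNumber 1 := by
  simp [encodeNumber, List.flatMap_map, oneNumbers, Computability.encodeNat,
    Computability.encodeNum, Computability.encodePosNum]

variable (D : FieldPresentation)

/-- The field element all of whose coefficients are one. -/
noncomputable def allOnes : D.Carrier :=
  AdjoinRoot.mk D.modulus (∑ i ∈ Finset.range D.modulus.natDegree, X ^ i)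

theorem coeff_allOnes {i : ℕ} (hi : i < D.modulus.natDegree) :
    (AdjoinRoot.modByMonicHom D.monic (allOnes D)).coeff i = 1 := by
  have hdeg : (∑ i ∈ Finset.range D.modulus.natDegree, (X : (ZMod D.p)[X]) ^ i).degree <
      D.modulus.degree := by
    rw [degree_eq_natDegree D.monic.ne_zero]
    refine (degree_sum_le _ _).trans_lt ?_
    rw [Finset.sup_lt_iff (WithBot.bot_lt_coe _)]
    intro j hj
    rw [degree_X_pow]
    exact_mod_cast Finset.mem_range.1 hj
  rw [allOnes, AdjoinRoot.modByMonicHom_mk, (modByMonic_eq_self_iff D.monic).2 hdeg,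
    finsetSum_coeff]
  simp [coeff_X_pow, hi]

theorem allOnes_ne_zero : allOnes D ≠ 0 := by
  intro h
  have := coeff_allOnes D (Irreducible.natDegree_pos D.irreducible)
  rw [h, map_zero, coeff_zero] at this
  exact zero_ne_one this

/-- An encoded element without its terminator. -/
noncomputable def encodeCoefficients (a : D.Carrier) : List Symbol :=
  (List.range D.modulus.natDegree).flatMap
    (fun i => encodeNumber ((AdjoinRoot.modByMonicHom D.monic a).coeff i).val)

theorem encodeElement_eq (a : D.Carrier) :
    encodeElement D a = encodeCoefficients D a ++ [Symbol.endEntry] := rfl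

theorem mem_encodeNumber {a : ℕ} {x : Symbol} (h : x ∈ encodeNumber a) :
    x ≠ Symbol.endEntry ∧ x ≠ Symbol.endColumn ∧ x ≠ Symbol.endPart := by
  simp only [encodeNumber, List.mem_append, List.mem_map, List.mem_singleton] at h
  rcases h with ⟨b, -, rfl⟩ | rfl <;> simp

theorem mem_encodeCoefficients {a : D.Carrier} {x : Symbol} (h : x ∈ encodeCoefficients D a) :
    x ≠ Symbol.endEntry ∧ x ≠ Symbol.endColumn ∧ x ≠ Symbol.endPart := by
  obtain ⟨i, -, hi⟩ := List.mem_flatMap.1 h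
  exact mem_encodeNumber hi

theorem flatMap_encodeElement_zeroNumbers (a : D.Carrier) :
    (encodeElement D a).flatMap zeroNumbers = encodeElement D 0 := by
  simp [encodeElement, List.flatMap_append, List.flatMap_assoc, flatMap_encodeNumber_zeroNumbers,
    zeroNumbers]

/-- This is why `θ` is `allOnes`: all coefficients are rewritten alike, whereas `θ = 1` would
require telling the constant coefficient apart. -/
theorem flatMap_encodeElement_oneNumbers (a : D.Carrier) :
    (encodeElement D a).flatMap oneNumbers = encodeElement D (allOnes D) := by
  simp only [encodeElement, List.flatMap_append, List.flatMap_assoc,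
    flatMap_encodeNumber_oneNumbers]
  congr 1
  refine List.flatMap_congr fun i hi => ?_
  rw [coeff_allOnes D (List.mem_range.1 hi), ZMod.val_one]

/-- The entries of a column. -/
noncomputable def encodeColumn {k : ℕ} (v : Fin k → D.Carrier) : List Symbol :=
  (List.finRange k).flatMap fun i => encodeElement D (v i)

theorem encodeColumn_succ {k : ℕ} (v : Fin (k + 1) → D.Carrier) :
    encodeColumn D v = encodeElement D (v 0) ++ encodeColumn D fun i => v i.succ := by
  rw [encodeColumn, List.finRange_succ, List.flatMap_cons, List.flatMap_map, encodeColumn]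

theorem encodeColumn_extend {k : ℕ} (a b : D.Carrier) (v : Fin k → D.Carrier) :
    encodeColumn D (extend a b v) = encodeElement D a ++ (encodeElement D b ++ encodeColumn D v) := by
  rw [encodeColumn_succ, encodeColumn_succ]; rfl

theorem mem_encodeColumn {k : ℕ} {v : Fin k → D.Carrier} {x : Symbol} (h : x ∈ encodeColumn D v) :
    x ≠ Symbol.endColumn ∧ x ≠ Symbol.endPart := by
  obtain ⟨i, -, hi⟩ := List.mem_flatMap.1 h
  rw [encodeElement_eq, List.mem_append, List.mem_singleton] at hi
  rcases hi with hi | rfl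
  · exact (mem_encodeCoefficients D hi).2
  · simp

theorem encodeMatrix_eq {k n : ℕ} (A : Matrix (Fin k) (Fin n) D.Carrier) :
    encodeMatrix D A = ((List.finRange n).map A.col).flatMap
      (fun v => encodeColumn D v ++ [Symbol.endColumn]) ++ [Symbol.endPart] := by
  rw [List.flatMap_map]; rfl

theorem flatMap_encodeColumn_zeroNumbers {k : ℕ} (v : Fin k → D.Carrier) :
    (encodeColumn D v).flatMap zeroNumbers = encodeColumn D (0 : Fin k → D.Carrier) := by
  simp [encodeColumn, List.flatMap_assoc, flatMap_encodeElement_zeroNumbers]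

theorem transduce_onHead_encodeColumn (g : Symbol → List Symbol) {k : ℕ}
    (v : Fin (k + 1) → D.Carrier) :
    transduce (onHead g) true (encodeColumn D v ++ [Symbol.endColumn]) =
      (encodeElement D (v 0)).flatMap g := by
  rw [encodeColumn_succ, encodeElement_eq, List.append_assoc, List.append_assoc]
  exact transduce_onHead g _ _ fun x hx =>
    ⟨(mem_encodeCoefficients D hx).1, (mem_encodeCoefficients D hx).2.1⟩

/-- Each gadget column is assembled from two head entries, which carry no column terminator, and a
tail that does. The head entries are modelled on the first entry of `v`, so that they get the right
number of coefficients; this needs `0 < k`. -/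
theorem columnOutput_encodeColumn {k : ℕ} (hk : 0 < k) (v : Fin k → D.Carrier) :
    columnOutput reductionWords (encodeColumn D v) =
      (block (allOnes D) v).flatMap fun u => encodeColumn D u ++ [Symbol.endColumn] := by
  obtain ⟨k, rfl⟩ := Nat.exists_eq_succ_of_ne_zero hk.ne'
  have h0 : transduce Rewriting.headZero.word true (encodeColumn D v ++ [Symbol.endColumn]) =
      encodeElement D 0 := by
    rw [Rewriting.word, transduce_onHead_encodeColumn, flatMap_encodeElement_zeroNumbers]
  have h1 : transduce Rewriting.headOne.word true (encodeColumn D v ++ [Symbol.endColumn]) =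
      encodeElement D (allOnes D) := by
    rw [Rewriting.word, transduce_onHead_encodeColumn, flatMap_encodeElement_oneNumbers]
  have h2 : transduce Rewriting.copy.word true (encodeColumn D v ++ [Symbol.endColumn]) =
      encodeColumn D v ++ [Symbol.endColumn] := by
    rw [Rewriting.word, transduce_const, List.flatMap_singleton']
  have h3 : transduce Rewriting.zeros.word true (encodeColumn D v ++ [Symbol.endColumn]) =
      encodeColumn D (0 : Fin (k + 1) → D.Carrier) ++ [Symbol.endColumn] := by
    rw [Rewriting.word, transduce_const, List.flatMap_append, flatMap_encodeColumn_zeroNumbers]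
    rfl
  rw [columnOutput_reductionWords]
  simp only [rewritings, block, List.replicate, List.flatten_cons, List.flatten_nil,
    List.flatMap_cons, List.flatMap_nil, List.cons_append, List.nil_append, List.append_nil,
    h0, h1, h2, h3, encodeColumn_extend, List.append_assoc]

theorem encodeMatrix_reduceMatrix {k n : ℕ} (hk : 0 < k) (A : Matrix (Fin k) (Fin n) D.Carrier) :
    encodeMatrix D (reduceMatrix (allOnes D) A) =
      ((List.finRange n).map fun j => encodeColumn D (A.col j)).reverse.flatMap
        (columnOutput reductionWords) ++ [Symbol.endPart] := by
  have h : ((List.finRange n).map fun j => encodeColumn D (A.col j)) =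
      ((List.finRange n).map A.col).map (encodeColumn D) := by rw [List.map_map]; rfl
  rw [encodeMatrix_eq, reduceMatrix, map_finRange_ofColumns, h,
    ← List.map_reverse (f := encodeColumn D)]
  generalize ((List.finRange n).map A.col).reverse = L
  rw [List.flatMap_map, List.flatMap_assoc]
  congr 1
  exact List.flatMap_congr fun v _ => (columnOutput_encodeColumn D hk v).symm

/-- The number of steps of the machine is at most a constant times the length of its input. -/
theorem outputsWithin_reduce (x : MatrixPair D.Carrier) :
    OutputsWithin (machine reductionWords) (encodeInstance D x)
      (encodeInstance D (reduce (allOnes D) x)) (104 * (encodeInstance D x).length) := by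
  have hc : ∀ A : Matrix (Fin x.k) (Fin x.n) D.Carrier,
      ∀ c ∈ (List.finRange x.n).map fun j => encodeColumn D (A.col j),
        Symbol.endColumn ∉ c ∧ Symbol.endPart ∉ c := by
    intro A c hc
    obtain ⟨j, -, rfl⟩ := List.mem_map.1 hc
    exact ⟨fun h => (mem_encodeColumn D h).1 rfl, fun h => (mem_encodeColumn D h).2 rfl⟩
  have hp : Symbol.endPart ∉ encodeNumber D.p ++
      (List.range (D.modulus.natDegree + 1)).flatMap
        (fun i => encodeNumber (D.modulus.coeff i).val) := by
    intro h
    rcases List.mem_append.1 h with h | h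
    · exact (mem_encodeNumber h).2.2 rfl
    · obtain ⟨i, -, hi⟩ := List.mem_flatMap.1 h
      exact (mem_encodeNumber hi).2.2 rfl
  have hm : ∀ A : Matrix (Fin x.k) (Fin x.n) D.Carrier, encodeMatrix D A =
      ((List.finRange x.n).map fun j => encodeColumn D (A.col j)).flatMap
        (fun c => c ++ [Symbol.endColumn]) ++ [Symbol.endPart] := by
    intro A
    rw [List.flatMap_map]; rfl
  -- Eleven columns per block with three stacks each make `m = 33`, and `3 * 33 + 5 = 104`.
  have h := runs_instance reductionWords length_reductionWords_le _ hp _ _ (hc x.G) (hc x.H)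
  rw [← encodeMatrix_reduceMatrix D x.k_pos, ← encodeMatrix_reduceMatrix D x.k_pos, ← hm,
    ← hm] at h
  exact outputsWithin_machine _ h

end Translation

/-! ### Polynomial bounds on the length of the input -/

section Length

/-- The leading binary digit is one. -/
theorem two_pow_length_encodePosNum_le (a : PosNum) :
    2 ^ (Computability.encodePosNum a).length ≤ 2 * (a : ℕ) := by
  induction a with
  | one => simp [Computability.encodePosNum]
  | bit1 a ih =>
    rw [Computability.encodePosNum, List.length_cons, pow_succ, PosNum.cast_bit1]
    omega
  | bit0 a ih =>
    rw [Computability.encodePosNum, List.length_cons, pow_succ, PosNum.cast_bit0]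
    omega

theorem length_encodeNumber_le {a q : ℕ} (h : a ≤ q) :
    (encodeNumber a).length ≤ Nat.log 2 q + 2 := by
  rw [encodeNumber, List.length_append, List.length_map, List.length_singleton,
    Computability.encodeNat]
  rcases h' : (a : Num) with _ | b
  · simp [Computability.encodeNum]
  · have hb : (b : ℕ) = a := by
      have := congrArg (fun n : Num => (n : ℕ)) h'
      simpa using this.symm
    have h1 := two_pow_length_encodePosNum_le b
    rw [Computability.encodeNum]
    rcases h2 : (Computability.encodePosNum b).length with _ | l
    · omega
    · rw [h2, pow_succ, hb] at h1
      have := Nat.le_log_of_pow_le (by norm_num : 1 < 2) (by omega : 2 ^ l ≤ q)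
      omega

theorem length_flatMap_le_mul {α β : Type} (L : List α) (f : α → List β) (s : ℕ)
    (h : ∀ a ∈ L, (f a).length ≤ s) : (L.flatMap f).length ≤ L.length * s := by
  induction L with
  | nil => simp
  | cons a L ih =>
    obtain ⟨ha, hL⟩ := List.forall_mem_cons.1 h
    have := ih hL
    rw [List.flatMap_cons, List.length_append, List.length_cons, add_mul]
    omega

variable (D : FieldPresentation)

theorem FieldPresentation.q_eq : D.q = D.p ^ D.modulus.natDegree := by
  have : Module.Finite (ZMod D.p) D.Carrier := D.monic.finite_adjoinRoot
  rw [FieldPresentation.q, Module.natCard_eq_pow_finrank (K := ZMod D.p), Nat.card_zmod]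
  congr 1
  exact (AdjoinRoot.powerBasis' D.monic).finrank

theorem FieldPresentation.p_le_q : D.p ≤ D.q := by
  rw [D.q_eq]
  exact Nat.le_self_pow (Irreducible.natDegree_pos D.irreducible).ne' _

/-- Since `q = p ^ r` with `p ≥ 2`, the degree is at most logarithmic in `q`. -/
theorem FieldPresentation.natDegree_le_log_q : D.modulus.natDegree ≤ Nat.log 2 D.q := by
  refine Nat.le_log_of_pow_le (by norm_num) ?_
  rw [D.q_eq]
  exact Nat.pow_le_pow_left D.prime.two_le _

theorem length_encodeNumber_val_le (a : ZMod D.p) :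
    (encodeNumber a.val).length ≤ Nat.log 2 D.q + 2 :=
  length_encodeNumber_le ((ZMod.val_lt a).le.trans D.p_le_q)

theorem length_encodeField_le {N : ℕ} (hN : Nat.log 2 D.q ≤ N) :
    (encodeField D).length ≤ (N + 2) * (N + 2) + 1 := by
  have h1 := length_encodeNumber_le D.p_le_q
  have h2 := length_flatMap_le_mul (List.range (D.modulus.natDegree + 1))
    (fun i => encodeNumber (D.modulus.coeff i).val) (N + 2)
    fun i _ => (length_encodeNumber_val_le D _).trans (by omega)
  have h3 : (D.modulus.natDegree + 1) * (N + 2) ≤ (N + 1) * (N + 2) :=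
    Nat.mul_le_mul_right _ (by have := D.natDegree_le_log_q; omega)
  rw [List.length_range] at h2
  simp only [encodeField, List.length_append, List.length_singleton]
  nlinarith

theorem length_encodeElement_le {N : ℕ} (hN : Nat.log 2 D.q ≤ N) (a : D.Carrier) :
    (encodeElement D a).length ≤ N * (N + 2) + 1 := by
  have h2 := length_flatMap_le_mul (List.range D.modulus.natDegree)
    (fun i => encodeNumber ((AdjoinRoot.modByMonicHom D.monic a).coeff i).val) (N + 2)
    fun i _ => (length_encodeNumber_val_le D _).trans (by omega)
  rw [List.length_range] at h2
  rw [encodeElement, List.length_append, List.length_singleton]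
  exact Nat.add_le_add_right
    (h2.trans (Nat.mul_le_mul_right _ (D.natDegree_le_log_q.trans hN))) 1

theorem length_encodeMatrix_le {N k n : ℕ} (hN : Nat.log 2 D.q ≤ N) (hk : k ≤ N) (hn : n ≤ N)
    (A : Matrix (Fin k) (Fin n) D.Carrier) :
    (encodeMatrix D A).length ≤ N * (N * (N * (N + 2) + 1) + 1) + 1 := by
  have h1 : ∀ j, ((List.finRange k).flatMap fun i => encodeElement D (A i j)).length ≤
      N * (N * (N + 2) + 1) := fun j => by
    refine (length_flatMap_le_mul _ _ _ fun i _ => length_encodeElement_le D hN _).trans ?_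
    rw [List.length_finRange]
    exact Nat.mul_le_mul_right _ hk
  have h2 := length_flatMap_le_mul (List.finRange n)
    (fun j => (List.finRange k).flatMap (fun i => encodeElement D (A i j)) ++ [Symbol.endColumn])
    (N * (N * (N + 2) + 1) + 1) fun j _ => by
      rw [List.length_append]
      exact Nat.add_le_add_right (h1 j) 1
  rw [List.length_finRange] at h2
  rw [encodeMatrix, List.length_append, List.length_singleton]
  exact Nat.add_le_add_right (h2.trans (Nat.mul_le_mul_right _ hn)) 1

theorem length_encodeInstance_le {N : ℕ} {x : MatrixPair D.Carrier} (hN : Nat.log 2 D.q ≤ N)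
    (hk : x.k ≤ N) (hn : x.n ≤ N) :
    (encodeInstance D x).length ≤ ((N + 2) * (N + 2) + 1) +
      (N * (N * (N * (N + 2) + 1) + 1) + 1) + (N * (N * (N * (N + 2) + 1) + 1) + 1) := by
  rw [encodeInstance, List.length_append, List.length_append]
  exact Nat.add_le_add (Nat.add_le_add (length_encodeField_le D hN)
    (length_encodeMatrix_le D hN hk hn _)) (length_encodeMatrix_le D hN hk hn _)

/-- A bound for the running time. -/
noncomputable def timeBound : ℕ[X] :=
  104 * (((X + 2) * (X + 2) + 1) + (X * (X * (X * (X + 2) + 1) + 1) + 1) +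
    (X * (X * (X * (X + 2) + 1) + 1) + 1))

theorem outputsWithin_timeBound {N : ℕ} {x : MatrixPair D.Carrier} (hN : Nat.log 2 D.q ≤ N)
    (hk : x.k ≤ N) (hn : x.n ≤ N) :
    OutputsWithin (machine reductionWords) (encodeInstance D x)
      (encodeInstance D (reduce (allOnes D) x)) (timeBound.eval N) := by
  obtain ⟨h⟩ := outputsWithin_reduce D x
  refine ⟨⟨h.toEvalsTo, h.steps_le_m.trans ?_⟩⟩
  have := Nat.mul_le_mul_left 104 (length_encodeInstance_le D hN hk hn)
  simpa [timeBound] using this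

end Length

end CodeEquivalence

theorem mainTheorem2 :
    ∃ (f : ∀ D : CodeEquivalence.FieldPresentation,
          CodeEquivalence.MatrixPair D.Carrier → CodeEquivalence.MatrixPair D.Carrier)
      (M : Turing.TM2ComputableAux CodeEquivalence.Symbol CodeEquivalence.Symbol)
      (T : Polynomial ℕ),
      -- correctness of the reduction
      (∀ (D : CodeEquivalence.FieldPresentation) (x : CodeEquivalence.MatrixPair D.Carrier),
        x.PCE ↔ (f D x).SPCE) ∧
      -- pairs of generator matrices go to pairs of generator matrices
      (∀ (D : CodeEquivalence.FieldPresentation) (x : CodeEquivalence.MatrixPair D.Carrier),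
        x.IsGeneratorPair → (f D x).IsGeneratorPair) ∧
      -- running time in terms of `n` and `log q` on pairs of generator matrices
      (∀ (D : CodeEquivalence.FieldPresentation) (x : CodeEquivalence.MatrixPair D.Carrier),
        x.IsGeneratorPair →
          CodeEquivalence.OutputsWithin M (CodeEquivalence.encodeInstance D x)
            (CodeEquivalence.encodeInstance D (f D x)) (T.eval (x.n + Nat.log 2 D.q))) ∧
      -- running time on arbitrary pairs, where `k` may exceed `n`
      (∀ (D : CodeEquivalence.FieldPresentation) (x : CodeEquivalence.MatrixPair D.Carrier),
        CodeEquivalence.OutputsWithin M (CodeEquivalence.encodeInstance D x)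
          (CodeEquivalence.encodeInstance D (f D x)) (T.eval (x.k + x.n + Nat.log 2 D.q))) :=
  ⟨fun D => CodeEquivalence.reduce (CodeEquivalence.allOnes D),
    CodeEquivalence.machine CodeEquivalence.reductionWords, CodeEquivalence.timeBound,
    fun D => CodeEquivalence.pce_iff_spce_reduce (CodeEquivalence.allOnes_ne_zero D),
    fun D _ => CodeEquivalence.isGeneratorPair_reduce (CodeEquivalence.allOnes_ne_zero D),
    -- Independence of the rows bounds `k` by `n`, so `n + log q` dominates all three parameters.
    fun D _ hx => CodeEquivalence.outputsWithin_timeBound D (Nat.le_add_left _ _)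
      (hx.k_le_n.trans (Nat.le_add_right _ _)) (Nat.le_add_right _ _),
    fun D _ => CodeEquivalence.outputsWithin_timeBound D (Nat.le_add_left _ _)
      ((Nat.le_add_right _ _).trans (Nat.le_add_right _ _))
      ((Nat.le_add_left _ _).trans (Nat.le_add_right _ _))⟩
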